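/- **Theorem 3.2 (H. X. Sinh).** A *Gr-category* is a (small) monoidal category $(\mathbb G,\otimes,I,\mathbf a,\mathbf l,\mathbf r)$, with $\mathbf a_{X,Y,Z}:X\otimes(Y\otimes Z)\to(X\otimes Y)\otimes Z$, in which every morphism is an isomorphism and every object is invertible for $\otimes$. Let $\pi_0\mathbb G$ be the group of isomorphism classes of objects under $\otimes$, and let $\pi_1\mathbb G=\mathrm{Aut}(I)$, an abelian group written additively. For $u\in\pi_1\mathbb G$ and an object $X$ let $\gamma_X(u)=\mathbf l_X(u\otimes \mathrm{id}_X)\mathbf l_X^{-1}$ and $\delta_X(u)=\mathbf r_X(\mathrm{id}_X\otimes u)\mathbf r_X^{-1}$; then $\gamma_X:\pi_1\mathbb G\to\mathrm{Aut}(X)$ is an isomorphism, and $[X]u=\gamma_X^{-1}\delta_X(u)$ makes $\pi_1\mathbb G$ a $\pi_0\mathbb G$-module. Choose an object $X_s$ in each class $s\in\pi_0\mathbb G$ and, for each object $X\in s$, an isomorphism $i_X:X_s\to X$, with $i_{X_s}=\mathrm{id}$. Put $m_{s,t}=i_{X_s\otimes X_t}^{-1}:X_s\otimes X_t\to X_{st}$.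 The equation $$\gamma_{X_{rst}}(h_{\mathbb G}(r,s,t))\circ m_{r,st}\circ(\mathrm{id}\otimes m_{s,t})=m_{rs,t}\circ(m_{r,s}\otimes\mathrm{id})\circ\mathbf a_{X_r,X_s,X_t}$$ defines a 3-cocycle $h_{\mathbb G}$ of $\pi_0\mathbb G$ with values in $\pi_1\mathbb G$. Let $\Pi$ be a group and $A$ a $\Pi$-module. A *pre-stick of type $(\Pi,A)$* on $\mathbb G$ is a pair of group isomorphisms $p:\Pi\to\pi_0\mathbb G$, $q:A\to\pi_1\mathbb G$ with $q(su)=p(s)q(u)$. A *morphism* $(\mathbb G,p,q)\to(\mathbb G',p',q')$ is a (strong) monoidal functor $F:\mathbb G\to\mathbb G'$ with $F_0p=p'$ and $F_1q=q'$, where $F_0[X]=[FX]$ and $F_1(u)=\gamma_{FI}^{-1}(F(u))$. The existence of a morphism is an equivalence relation on Gr-categories with a pre-stick of type $(\Pi,A)$; let $\mathcal{CG}[\Pi,A]$ be the collection of equivalence classes. Then there is a bijection $$\Gamma:\mathcal{CG}[\Pi,A]\to H^3(\Pi,A),\qquad [(\mathbb G,p,q)]\mapsto q_*^{-1}p^*[h_{\mathbb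 G}],$$ where $q_*^{-1}p^*[h_{\mathbb G}]$ is the class of $(r,s,t)\mapsto q^{-1}(h_{\mathbb G}(p(r),p(s),p(t)))$. In particular this class does not depend on the choice of the $X_s$ and $i_X$. -/

import Mathlib

open CategoryTheory MonoidalCategory

universe u

namespace GrCat

noncomputable section

section GroupModules

variable (P A : Type u) [Group P] [AddCommGroup A] [DistribMulAction P A]

instance : SMulCommClass P (ULift.{u} ℤ) A := ⟨fun g n a => smul_comm g n.down a⟩

/-- A `P`-module `A`, regarded as a linear representation of `P`. The coefficient ring is a copy of
`ℤ` in the universe of `P` and `A`. -/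
abbrev moduleRep : Rep.{u} (ULift.{u} ℤ) P := Rep.ofDistribMulAction (ULift.{u} ℤ) P A

/-- The third cohomology group `H³(P, A)` of a group `P` with coefficients in a `P`-module `A`. -/
abbrev H3 := groupCohomology (moduleRep P A) 3

variable {P A}

/-- Let `p : P → P'` be a homomorphism of groups and let `f : A' → A` be an additive map from a
`P'`-module to a `P`-module with `f (p s • a) = s • f a`. This is the map `f_* p^*` from
`H³(P', A')` to `H³(P, A)`, which sends the class of a cocycle `h` to the class of
`(r, s, t) ↦ f (h (p r, p s, p t))`. -/
def H3.map {P' A' : Type u} [Group P'] [AddCommGroup A'] [DistribMulAction P' A']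
    (p : P →* P') (f : A' →+ A) (hf : ∀ (s : P) (a : A'), f (p s • a) = s • f a) :
    H3 P' A' → H3 P A :=
  groupCohomology.map (A := moduleRep P' A') (B := moduleRep P A) p
    (Rep.ofHom
      { toFun := f
        map_add' := f.map_add
        map_smul' := fun n a => map_zsmul f n.down a
        isIntertwining' := fun s => LinearMap.ext (hf s) }) 3

end GroupModules

/-- A Gr-category: a monoidal category in which every morphism is an isomorphism and every object
is invertible with respect to the tensor product. -/
class IsGrCategory (C : Type u) [Category.{u} C] [MonoidalCategory C] : Prop
    extends IsGroupoid C where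
  exists_inverse : ∀ X : C, ∃ Y : C, Nonempty (X ⊗ Y ≅ 𝟙_ C) ∧ Nonempty (Y ⊗ X ≅ 𝟙_ C)

section Invariants

variable (C : Type u) [Category.{u} C]

/-- The set `π₀ C` of isomorphism classes of objects. -/
def Pi0 : Type u := Quotient (isIsomorphicSetoid C)

variable {C} in
/-- The isomorphism class of an object. -/
def Pi0.mk (X : C) : Pi0 C := Quotient.mk (isIsomorphicSetoid C) X

theorem Pi0.mk_eq_iff {X Y : C} : Pi0.mk X = Pi0.mk Y ↔ Nonempty (X ≅ Y) :=
  Quotient.eq (r := isIsomorphicSetoid C)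

theorem Pi0.mk_surjective : Function.Surjective (Pi0.mk (C := C)) := Quotient.mk_surjective

variable [MonoidalCategory C]

/-- The multiplication `[X] * [Y] = [X ⊗ Y]` on `π₀ C`. -/
instance : Mul (Pi0 C) where
  mul := Quotient.map₂ (fun X Y => X ⊗ Y)
    (fun _ _ ⟨e⟩ _ _ ⟨f⟩ => ⟨MonoidalCategory.tensorIso e f⟩)

instance : One (Pi0 C) := ⟨Pi0.mk (𝟙_ C)⟩

variable {C} in
theorem Pi0.mk_mul (X Y : C) : Pi0.mk X * Pi0.mk Y = Pi0.mk (X ⊗ Y) := rfl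

instance : Monoid (Pi0 C) where
  mul_assoc a b c := by
    obtain ⟨X, rfl⟩ := Pi0.mk_surjective C a
    obtain ⟨Y, rfl⟩ := Pi0.mk_surjective C b
    obtain ⟨Z, rfl⟩ := Pi0.mk_surjective C c
    exact (Pi0.mk_eq_iff C).2 ⟨α_ X Y Z⟩
  one_mul a := by
    obtain ⟨X, rfl⟩ := Pi0.mk_surjective C a
    exact (Pi0.mk_eq_iff C).2 ⟨λ_ X⟩
  mul_one a := by
    obtain ⟨X, rfl⟩ := Pi0.mk_surjective C a
    exact (Pi0.mk_eq_iff C).2 ⟨ρ_ X⟩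

theorem Pi0.exists_left_inv [IsGrCategory C] (s : Pi0 C) : ∃ t : Pi0 C, t * s = 1 := by
  obtain ⟨X, rfl⟩ := Pi0.mk_surjective C s
  obtain ⟨Y, -, e⟩ := IsGrCategory.exists_inverse X
  exact ⟨Pi0.mk Y, (Pi0.mk_eq_iff C).2 e⟩

/-- The group structure on `π₀ C`, induced by the tensor product. -/
instance [IsGrCategory C] : Group (Pi0 C) where
  inv s := (Pi0.exists_left_inv C s).choose
  inv_mul_cancel s := (Pi0.exists_left_inv C s).choose_spec

variable {C}

/-- The homomorphism `γ_X : Aut I → Aut X`, sending `u` to the automorphism of `X` that corresponds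
to `u ⊗ id_X` under the left unit constraint `I ⊗ X ≅ X`. -/
def gamma (X : C) : Aut (𝟙_ C) →* Aut X :=
  (λ_ X).conjAut.toMonoidHom.comp ((tensorRight X).mapAut (𝟙_ C))

/-- The homomorphism `δ_X : Aut I → Aut X`, sending `u` to the automorphism of `X` that corresponds
to `id_X ⊗ u` under the right unit constraint `X ⊗ I ≅ X`. -/
def delta (X : C) : Aut (𝟙_ C) →* Aut X :=
  (ρ_ X).conjAut.toMonoidHom.comp ((tensorLeft X).mapAut (𝟙_ C))

theorem gamma_hom (X : C) (u : Aut (𝟙_ C)) :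
    (gamma X u).hom = (λ_ X).inv ≫ u.hom ▷ X ≫ (λ_ X).hom := rfl

theorem delta_hom (X : C) (u : Aut (𝟙_ C)) :
    (delta X u).hom = (ρ_ X).inv ≫ X ◁ u.hom ≫ (ρ_ X).hom := rfl

theorem gamma_natural {X Y : C} (f : X ⟶ Y) (u : Aut (𝟙_ C)) :
    (gamma X u).hom ≫ f = f ≫ (gamma Y u).hom := by
  simp only [gamma_hom, Category.assoc]
  rw [← leftUnitor_naturality, ← whisker_exchange_assoc, leftUnitor_inv_naturality_assoc]

theorem delta_natural {X Y : C} (f : X ⟶ Y) (u : Aut (𝟙_ C)) :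
    (delta X u).hom ≫ f = f ≫ (delta Y u).hom := by
  simp only [delta_hom, Category.assoc]
  rw [← rightUnitor_naturality, whisker_exchange_assoc, rightUnitor_inv_naturality_assoc]

theorem gamma_unit (u : Aut (𝟙_ C)) : gamma (𝟙_ C) u = u := by
  ext
  rw [gamma_hom, unitors_equal, unitors_inv_equal, rightUnitor_naturality, Iso.inv_hom_id_assoc]

theorem delta_unit (u : Aut (𝟙_ C)) : delta (𝟙_ C) u = u := by
  ext
  rw [delta_hom, ← unitors_equal, ← unitors_inv_equal, leftUnitor_naturality,
    Iso.inv_hom_id_assoc]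

theorem gamma_tensor (X Y : C) (u : Aut (𝟙_ C)) :
    (gamma (X ⊗ Y) u).hom = (gamma X u).hom ▷ Y := by
  simp [gamma_hom]

theorem delta_tensor (X Y : C) (u : Aut (𝟙_ C)) :
    (delta (X ⊗ Y) u).hom = X ◁ (delta Y u).hom := by
  simp [delta_hom]

theorem delta_whiskerRight (X Y : C) (u : Aut (𝟙_ C)) :
    (delta X u).hom ▷ Y = X ◁ (gamma Y u).hom := by
  simp only [gamma_hom, delta_hom, comp_whiskerRight, MonoidalCategory.whiskerLeft_comp]
  rw [← cancel_epi ((ρ_ X).hom ▷ Y), ← cancel_mono ((ρ_ X).inv ▷ Y)]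
  simp

/-- The group `Aut I` is abelian. -/
instance : CommGroup (Aut (𝟙_ C)) where
  mul_comm u v := by
    ext
    have h := gamma_natural v.hom u
    rw [gamma_unit] at h
    exact h.symm

variable (C) in
/-- The abelian group `π₁ C` of automorphisms of the unit object, written additively. -/
abbrev Pi1 : Type u := Additive (Aut (𝟙_ C))

theorem gamma_add (X : C) (u v : Pi1 C) :
    (gamma X (u + v).toMul).hom = (gamma X u.toMul).hom ≫ (gamma X v.toMul).hom := by
  rw [add_comm, toMul_add, map_mul]
  rfl

section

variable [IsGrCategory C]

theorem tensorRight_isEquivalence (X : C) : (tensorRight X).IsEquivalence := by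
  obtain ⟨Y, ⟨e⟩, ⟨e'⟩⟩ := IsGrCategory.exists_inverse X
  have h₁ : ∀ {Z W : C} (f : Z ⟶ W), f ≫ (ρ_ W).inv ≫ W ◁ e.inv ≫ (α_ W X Y).inv =
      ((ρ_ Z).inv ≫ Z ◁ e.inv ≫ (α_ Z X Y).inv) ≫ (f ▷ X) ▷ Y := fun f => by
    rw [Category.assoc, Category.assoc, ← associator_inv_naturality_left, whisker_exchange_assoc,
      rightUnitor_inv_naturality_assoc]
  have h₂ : ∀ {Z W : C} (f : Z ⟶ W), (f ▷ Y) ▷ X ≫ (α_ W Y X).hom ≫ W ◁ e'.hom ≫ (ρ_ W).hom =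
      ((α_ Z Y X).hom ≫ Z ◁ e'.hom ≫ (ρ_ Z).hom) ≫ f := fun f => by
    rw [Category.assoc, Category.assoc, associator_naturality_left_assoc,
      ← whisker_exchange_assoc, rightUnitor_naturality]
  exact (CategoryTheory.Equivalence.mk (tensorRight X) (tensorRight Y)
    (NatIso.ofComponents
      (fun Z => (ρ_ Z).symm ≪≫ whiskerLeftIso Z e.symm ≪≫ (α_ Z X Y).symm) (fun f => h₁ f))
    (NatIso.ofComponents
      (fun Z => α_ Z Y X ≪≫ whiskerLeftIso Z e' ≪≫ ρ_ Z)
      (fun f => h₂ f))).isEquivalence_functor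

theorem gamma_bijective (X : C) : Function.Bijective (gamma X) := by
  have := tensorRight_isEquivalence X
  exact (λ_ X).conjAut.bijective.comp
    ((Functor.FullyFaithful.ofFullyFaithful (tensorRight X)).autMulEquivOfFullyFaithful
      (𝟙_ C)).bijective

/-- In a Gr-category `γ_X` is an isomorphism of groups. -/
def gammaEquiv (X : C) : Aut (𝟙_ C) ≃* Aut X :=
  MulEquiv.ofBijective (gamma X) (gamma_bijective X)

theorem gamma_gammaEquiv_symm (X : C) (f : Aut X) : gamma X ((gammaEquiv X).symm f) = f :=
  (gammaEquiv X).apply_symm_apply f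

/-- The map `γ_X⁻¹ ∘ δ_X` depends only on the isomorphism class of `X`. -/
theorem act_congr {X Y : C} (e : X ≅ Y) (u : Aut (𝟙_ C)) :
    (gammaEquiv X).symm (delta X u) = (gammaEquiv Y).symm (delta Y u) := by
  apply (gamma_bijective Y).1
  rw [gamma_gammaEquiv_symm]
  ext
  rw [← cancel_epi e.hom, ← gamma_natural, ← delta_natural, gamma_gammaEquiv_symm]

/-- The action `[X] • u = γ_X⁻¹ (δ_X u)` of `π₀ C` on `Aut I`. -/
def act (s : Pi0 C) (u : Aut (𝟙_ C)) : Aut (𝟙_ C) :=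
  Quotient.lift (s := isIsomorphicSetoid C) (fun X : C => (gammaEquiv X).symm (delta X u))
    (fun _ _ ⟨e⟩ => act_congr e u) s

theorem gamma_act (X : C) (u : Aut (𝟙_ C)) : gamma X (act (Pi0.mk X) u) = delta X u :=
  gamma_gammaEquiv_symm X _

/-- The `π₀ C`-module structure on `π₁ C`. -/
instance : DistribMulAction (Pi0 C) (Pi1 C) where
  smul s u := Additive.ofMul (act s u.toMul)
  one_smul u := by
    apply Additive.toMul.injective
    apply (gamma_bijective (𝟙_ C)).1
    refine (gamma_act (𝟙_ C) u.toMul).trans ?_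
    rw [gamma_unit, delta_unit]
  mul_smul s t u := by
    obtain ⟨X, rfl⟩ := Pi0.mk_surjective C s
    obtain ⟨Y, rfl⟩ := Pi0.mk_surjective C t
    apply Additive.toMul.injective
    apply (gamma_bijective (X ⊗ Y)).1
    refine (gamma_act (X ⊗ Y) u.toMul).trans ?_
    ext
    refine Eq.trans ?_ (gamma_tensor X Y _).symm
    refine Eq.trans ?_ (congrArg (fun f : Aut X => f.hom ▷ Y) (gamma_act X _).symm)
    rw [delta_whiskerRight, delta_tensor]
    exact congrArg (fun f : Aut Y => X ◁ f.hom) (gamma_act Y u.toMul).symm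
  smul_zero s := by
    obtain ⟨X, rfl⟩ := Pi0.mk_surjective C s
    apply Additive.toMul.injective
    apply (gamma_bijective X).1
    refine (gamma_act X 1).trans ?_
    rw [map_one]
    exact (map_one _).symm
  smul_add s u v := by
    obtain ⟨X, rfl⟩ := Pi0.mk_surjective C s
    apply Additive.toMul.injective
    apply (gamma_bijective X).1
    refine (gamma_act X (u.toMul * v.toMul)).trans ?_
    rw [map_mul]
    refine Eq.trans ?_ (map_mul (gamma X) (act (Pi0.mk X) u.toMul) (act (Pi0.mk X) v.toMul)).symm
    rw [gamma_act, gamma_act]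

theorem smul_def (s : Pi0 C) (u : Pi1 C) : s • u = Additive.ofMul (act s u.toMul) := rfl

theorem whiskerLeft_gamma (X Y : C) (u : Pi1 C) :
    X ◁ (gamma Y u.toMul).hom = (gamma (X ⊗ Y) (Pi0.mk X • u).toMul).hom := by
  rw [gamma_tensor, ← delta_whiskerRight, smul_def, toMul_ofMul, gamma_act]

end

section Cohomology

variable (C)

/-- A choice of an object `X_s` in every isomorphism class `s`, and of an isomorphism
`i_X : X_s ≅ X` for every object `X` of the class `s`, with `i_{X_s}` the identity. The choice need
not be adapted to the unit constraints (`X_1 = I`, `i_{I ⊗ X_s} = l⁻¹`, `i_{X_s ⊗ I} = r⁻¹`): those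
further conditions make the cocycle below normalized, but cannot be met in every Gr-category. -/
structure Stick where
  rep : Pi0 C → C
  mk_rep : ∀ s, Pi0.mk (rep s) = s
  iso : ∀ (s : Pi0 C) (X : C), Pi0.mk X = s → (rep s ≅ X)
  iso_rep : ∀ s, iso s (rep s) (mk_rep s) = Iso.refl (rep s)

open Classical in
instance : Nonempty (Stick C) :=
  ⟨{ rep := Quotient.out
     mk_rep := Quotient.out_eq
     iso := fun s X h =>
       if e : X = Quotient.out s then eqToIso e.symm
       else ((Pi0.mk_eq_iff C).1 ((Quotient.out_eq s).trans h.symm)).some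
     iso_rep := fun s => by simp }⟩

variable {C} (σ : Stick C)

namespace Stick

theorem mk_tensor {s t n : Pi0 C} (h : s * t = n) : Pi0.mk (σ.rep s ⊗ σ.rep t) = n := by
  rw [← Pi0.mk_mul, σ.mk_rep, σ.mk_rep, h]

/-- The isomorphism `X_s ⊗ X_t ≅ X_n`, the inverse of `i_{X_s ⊗ X_t}`, where `n = s * t`. -/
def mulIso (s t n : Pi0 C) (h : s * t = n) : σ.rep s ⊗ σ.rep t ≅ σ.rep n :=
  (σ.iso n (σ.rep s ⊗ σ.rep t) (σ.mk_tensor h)).symm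

/-- The automorphism of `X_{rst}` that measures the failure of
`X_r ⊗ (X_s ⊗ X_t) ≅ X_r ⊗ X_{st} ≅ X_{rst}` and
`X_r ⊗ (X_s ⊗ X_t) ≅ (X_r ⊗ X_s) ⊗ X_t ≅ X_{rs} ⊗ X_t ≅ X_{rst}` to agree: the second one is the
first one followed by it. -/
def assocAut (r s t : Pi0 C) : Aut (σ.rep (r * s * t)) :=
  (whiskerLeftIso (σ.rep r) (σ.mulIso s t (s * t) rfl) ≪≫
    σ.mulIso r (s * t) (r * s * t) (mul_assoc r s t).symm).symm ≪≫
  ((α_ (σ.rep r) (σ.rep s) (σ.rep t)).symm ≪≫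
    whiskerRightIso (σ.mulIso r s (r * s) rfl) (σ.rep t) ≪≫
    σ.mulIso (r * s) t (r * s * t) rfl)

variable [IsGrCategory C]

/-- The associativity constraint `h : (π₀ C)³ → π₁ C` which the reduced category, with objects the
elements `s` of `π₀ C` and morphisms `(s, u) : s ⟶ s` for `u ∈ π₁ C`, receives from `C` by transport
of structure along `s ↦ X_s`, `(s, u) ↦ γ_{X_s}(u)`. -/
def assoc (r s t : Pi0 C) : Pi1 C :=
  Additive.ofMul ((gammaEquiv (σ.rep (r * s * t))).symm (σ.assocAut r s t))

theorem gamma_assoc {r s t rs st n : Pi0 C} (h₁ : r * s = rs) (h₂ : s * t = st)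
    (h₃ : r * st = n) (h₄ : rs * t = n) :
    (α_ (σ.rep r) (σ.rep s) (σ.rep t)).inv ≫ (σ.mulIso r s rs h₁).hom ▷ σ.rep t ≫
      (σ.mulIso rs t n h₄).hom =
    σ.rep r ◁ (σ.mulIso s t st h₂).hom ≫ (σ.mulIso r st n h₃).hom ≫
      (gamma (σ.rep n) (σ.assoc r s t).toMul).hom := by
  subst h₁ h₂ h₄
  rw [assoc, toMul_ofMul, gamma_gammaEquiv_symm]
  simp [assocAut]

theorem assoc_cocycle (r s t w : Pi0 C) :
    r • σ.assoc s t w + σ.assoc r (s * t) w + σ.assoc r s t =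
      σ.assoc r s (t * w) + σ.assoc (r * s) t w := by
  obtain ⟨n, hn⟩ : ∃ n, n = r * s * t * w := ⟨_, rfl⟩
  have e₁ : r * (s * t * w) = n := by rw [hn]; simp only [mul_assoc]
  have e₂ : r * s * (t * w) = n := by rw [hn]; simp only [mul_assoc]
  have e₃ : s * (t * w) = s * t * w := (mul_assoc s t w).symm
  have e₄ : r * (s * t) = r * s * t := (mul_assoc r s t).symm
  have e₅ : r * s * t * w = n := hn.symm
  have e₆ : s * t * w = s * t * w := rfl
  let a := σ.rep r
  let b := σ.rep s
  let c := σ.rep t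
  let d := σ.rep w
  let B : a ⊗ (b ⊗ (c ⊗ d)) ≅ σ.rep n :=
    whiskerLeftIso a (whiskerLeftIso b (σ.mulIso t w _ rfl) ≪≫ σ.mulIso s (t * w) _ e₃) ≪≫
      σ.mulIso r (s * t * w) n e₁
  let T : ((a ⊗ b) ⊗ c) ⊗ d ⟶ σ.rep n :=
    ((σ.mulIso r s _ rfl).hom ▷ c) ▷ d ≫ (σ.mulIso (r * s) t _ rfl).hom ▷ d ≫
      (σ.mulIso (r * s * t) w n e₅).hom
  have key₁ : (α_ a b (c ⊗ d)).inv ≫ (α_ (a ⊗ b) c d).inv ≫ T =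
      B.hom ≫ (gamma (σ.rep n) (σ.assoc r s (t * w) + σ.assoc (r * s) t w).toMul).hom := by
    simp only [T, B, a, b, c, d, Iso.trans_hom, whiskerLeftIso_hom, Category.assoc,
      MonoidalCategory.whiskerLeft_comp]
    rw [← associator_inv_naturality_left_assoc, σ.gamma_assoc rfl rfl e₂ e₅,
      ← whisker_exchange_assoc, ← associator_inv_naturality_right_assoc]
    rw [reassoc_of% (σ.gamma_assoc rfl e₃ e₁ e₂), gamma_add]
  have key₂ : a ◁ (α_ b c d).inv ≫ (α_ a (b ⊗ c) d).inv ≫ (α_ a b c).inv ▷ d ≫ T =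
      B.hom ≫ (gamma (σ.rep n)
        (r • σ.assoc s t w + σ.assoc r (s * t) w + σ.assoc r s t).toMul).hom := by
    have h₁ := congrArg (fun f => f ▷ d) (σ.gamma_assoc (r := r) (s := s) (t := t) rfl rfl e₄ rfl)
    have h₂ := congrArg (fun f => a ◁ f) (σ.gamma_assoc (r := s) (s := t) (t := w) rfl rfl e₃ e₆)
    simp only [comp_whiskerRight, MonoidalCategory.whiskerLeft_comp] at h₁ h₂
    simp only [T, B, Iso.trans_hom, whiskerLeftIso_hom, Category.assoc,
      MonoidalCategory.whiskerLeft_comp]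
    rw [reassoc_of% h₁, ← gamma_tensor, gamma_natural, ← associator_inv_naturality_middle_assoc]
    rw [reassoc_of% (σ.gamma_assoc (r := r) (s := s * t) (t := w) e₄ rfl e₁ e₅)]
    have h₃ := whiskerLeft_gamma (σ.rep r) (σ.rep (s * t * w)) (σ.assoc s t w)
    have h₄ := gamma_natural (σ.mulIso r (s * t * w) n e₁).hom (r • σ.assoc s t w).toMul
    rw [σ.mk_rep] at h₃
    rw [reassoc_of% h₂, h₃, reassoc_of% h₄]
    simp only [gamma_add, Category.assoc]
    rfl
  have hp := congrArg (fun f => f ≫ T) (pentagon_inv (W := a) (X := b) (Y := c) (Z := d))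
  simp only [Category.assoc] at hp
  rw [key₁, key₂, cancel_epi] at hp
  exact Additive.toMul.injective ((gamma_bijective _).1 (Iso.ext hp))

theorem d_assoc :
    inhomogeneousCochains.d (moduleRep (Pi0 C) (Pi1 C)) 3 (fun g => σ.assoc (g 0) (g 1) (g 2)) = 0 := by
  funext g
  have h := σ.assoc_cocycle (g 0) (g 1) (g 2) (g 3)
  refine (inhomogeneousCochains.d_hom_apply (moduleRep (Pi0 C) (Pi1 C)) 3 _ g).trans ?_
  have e₃ : (-1 : ULift.{u} ℤ) ^ 3 = -1 := by ring
  have e₄ : (-1 : ULift.{u} ℤ) ^ 4 = 1 := by ring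
  have key : ∀ a b c d e : Pi1 C, a + ((-1 : ULift.{u} ℤ) • b + ((1 : ULift.{u} ℤ) • c +
      ((-1 : ULift.{u} ℤ) • d + (1 : ULift.{u} ℤ) • e))) = a + c + e - (d + b) := by
    intro a b c d e
    rw [neg_smul, neg_smul, one_smul, one_smul, one_smul, one_smul]
    abel
  simp only [Fin.sum_univ_succ]
  simp [Fin.contractNth, e₃, e₄]
  exact (key _ _ _ _ _).trans (sub_eq_zero.2 h)

/-- The class `[h] ∈ H³(π₀ C, π₁ C)` of the associativity constraint of the reduced category. -/
def cohomologyClass : H3 (Pi0 C) (Pi1 C) :=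
  groupCohomology.π (moduleRep (Pi0 C) (Pi1 C)) 3
    (groupCohomology.cocyclesMk (fun g => σ.assoc (g 0) (g 1) (g 2)) σ.d_assoc)

end Stick

end Cohomology

end Invariants

section GrFunctors

variable {C D E : Type u} [Category.{u} C] [MonoidalCategory C] [Category.{u} D]
  [MonoidalCategory D] [Category.{u} E] [MonoidalCategory E]

/-- The map `F₀ : π₀ C → π₀ D`, `[X] ↦ [F X]`, induced by a functor. -/
def mapPi0 (F : C ⥤ D) : Pi0 C → Pi0 D :=
  Quotient.map F.obj (fun _ _ ⟨e⟩ => ⟨F.mapIso e⟩)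

/-- The map `F₁ : π₁ C → π₁ D`, `u ↦ γ_{F I}⁻¹ (F u)`, induced by a functor. -/
def mapPi1 [IsGrCategory D] (F : C ⥤ D) (u : Pi1 C) : Pi1 D :=
  Additive.ofMul ((gammaEquiv (F.obj (𝟙_ C))).symm (F.mapAut (𝟙_ C) u.toMul))

open Functor.LaxMonoidal Functor.OplaxMonoidal Functor.Monoidal

theorem gamma_mapPi1_unit [IsGrCategory D] (F : C ⥤ D) (u : Pi1 C) :
    (gamma (F.obj (𝟙_ C)) (mapPi1 F u).toMul).hom = F.map u.toMul.hom := by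
  rw [mapPi1, toMul_ofMul, gamma_gammaEquiv_symm]
  rfl

/-- For a monoidal functor, `F γ_X(u) = γ_{F X}(F₁ u)`. -/
theorem map_gamma [IsGrCategory D] (F : C ⥤ D) [F.Monoidal] (X : C) (u : Pi1 C) :
    F.map (gamma X u.toMul).hom = (gamma (F.obj X) (mapPi1 F u).toMul).hom := by
  have h := gamma_mapPi1_unit F u
  have h₁ := μ_natural_left F u.toMul.hom X
  rw [← h, ← gamma_tensor, gamma_natural, cancel_epi] at h₁
  rw [gamma_hom, F.map_comp, F.map_comp, ← h₁, gamma_natural,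
    Iso.map_inv_hom_id_assoc]

theorem mapPi1_eq_of [IsGrCategory D] (F : C ⥤ D) [F.Monoidal] (X : C) (u : Pi1 C) (v : Pi1 D)
    (h : F.map (gamma X u.toMul).hom = (gamma (F.obj X) v.toMul).hom) : mapPi1 F u = v := by
  rw [map_gamma] at h
  exact Additive.toMul.injective ((gamma_bijective _).1 (Iso.ext h))

theorem mapPi1_id [IsGrCategory C] (u : Pi1 C) : mapPi1 (𝟭 C) u = u :=
  mapPi1_eq_of (𝟭 C) (𝟙_ C) u u rfl

theorem mapPi1_comp [IsGrCategory D] [IsGrCategory E] (F : C ⥤ D) [F.Monoidal] (G : D ⥤ E)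
    [G.Monoidal] (u : Pi1 C) : mapPi1 (F ⋙ G) u = mapPi1 G (mapPi1 F u) := by
  apply mapPi1_eq_of (F ⋙ G) (𝟙_ C)
  rw [Functor.comp_map, map_gamma, map_gamma]
  rfl

/-- A monoidal functor of Gr-categories that induces bijections on `π₀` and `π₁` is an
equivalence. -/
theorem isEquivalence_of_bijective [IsGrCategory C] [IsGrCategory D] (F : C ⥤ D) [F.Monoidal]
    (h₀ : Function.Bijective (mapPi0 F)) (h₁ : Function.Bijective (mapPi1 F)) :
    F.IsEquivalence where
  faithful := ⟨fun {X Y} f g h => by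
    obtain ⟨u, hu⟩ := (gamma_bijective X).2 (asIso f ≪≫ (asIso g).symm)
    have hu' : (gamma X u).hom = f ≫ inv g := congrArg Iso.hom hu
    have h₂ := map_gamma F X (Additive.ofMul u)
    have h₃ := map_gamma F X (0 : Pi1 C)
    rw [toMul_ofMul, hu', F.map_comp, h, ← F.map_comp, IsIso.hom_inv_id] at h₂
    rw [toMul_zero, map_one] at h₃
    have h₄ := h₁.1 (Additive.toMul.injective
      ((gamma_bijective _).1 (Iso.ext (h₂.symm.trans h₃))))
    have h₅ : u = 1 := congrArg Additive.toMul h₄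
    rw [h₅, map_one] at hu'
    rwa [← cancel_mono (inv g), IsIso.hom_inv_id, eq_comm]⟩
  full := ⟨fun {X Y} f => by
    obtain ⟨e⟩ := (Pi0.mk_eq_iff C).1 (h₀.1 (((Pi0.mk_eq_iff D).2 ⟨asIso f⟩ :
      Pi0.mk (F.obj X) = Pi0.mk (F.obj Y))))
    obtain ⟨v, hv⟩ := (gamma_bijective (F.obj X)).2 (asIso f ≪≫ (F.mapIso e).symm)
    obtain ⟨u, hu⟩ := h₁.2 (Additive.ofMul v)
    have hv' : (gamma (F.obj X) v).hom = f ≫ F.map e.inv := congrArg Iso.hom hv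
    refine ⟨(gamma X u.toMul).hom ≫ e.hom, ?_⟩
    rw [F.map_comp, map_gamma, hu, toMul_ofMul, hv', Category.assoc, ← F.map_comp,
      Iso.inv_hom_id, F.map_id, Category.comp_id]⟩
  essSurj := ⟨fun Y => by
    obtain ⟨s, hs⟩ := h₀.2 (Pi0.mk Y)
    obtain ⟨X, rfl⟩ := Pi0.mk_surjective C s
    exact ⟨X, (Pi0.mk_eq_iff D).1 hs⟩⟩

end GrFunctors

/-- A pre-stick of the type `(P, A)` of a Gr-category `C`: isomorphisms of groups `p : P → π₀ C` and
`q : A → π₁ C` that are compatible with the actions. -/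
structure PreStick (P A : Type u) [Group P] [AddCommGroup A] [DistribMulAction P A]
    (C : Type u) [Category.{u} C] [MonoidalCategory C] [IsGrCategory C] where
  p : P ≃* Pi0 C
  q : A ≃+ Pi1 C
  q_smul : ∀ (s : P) (a : A), q (s • a) = p s • q a

/-- The map `q_*⁻¹ p^* : H³(π₀ C, π₁ C) → H³(P, A)` defined by a pre-stick `(p, q)`. -/
def PreStick.transfer {P A : Type u} [Group P] [AddCommGroup A] [DistribMulAction P A]
    {C : Type u} [Category.{u} C] [MonoidalCategory C] [IsGrCategory C] (ε : PreStick P A C) :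
    H3 (Pi0 C) (Pi1 C) → H3 P A :=
  H3.map ε.p.toMonoidHom ε.q.symm.toAddMonoidHom fun s a => by
    apply ε.q.injective
    refine (ε.q.apply_symm_apply _).trans ?_
    rw [ε.q_smul]
    exact congrArg (ε.p s • ·) (ε.q.apply_symm_apply a).symm

/-- A Gr-category together with a pre-stick of the type `(P, A)`. -/
structure PreStickedGrCategory (P A : Type u) [Group P] [AddCommGroup A]
    [DistribMulAction P A] where
  carrier : Type u
  [category : Category.{u} carrier]
  [monoidal : MonoidalCategory carrier]
  [isGrCategory : IsGrCategory carrier]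
  preStick : PreStick P A carrier

namespace PreStickedGrCategory

attribute [instance] category monoidal isGrCategory

variable {P A : Type u} [Group P] [AddCommGroup A] [DistribMulAction P A]

/-- A morphism of Gr-categories with pre-sticks of the type `(P, A)`: a monoidal functor `F` with
`F₀ ∘ p = p'` and `F₁ ∘ q = q'`. -/
structure Hom (G G' : PreStickedGrCategory P A) where
  functor : G.carrier ⥤ G'.carrier
  [functor_monoidal : functor.Monoidal]
  mapPi0_p : ∀ s : P, mapPi0 functor (G.preStick.p s) = G'.preStick.p s
  mapPi1_q : ∀ a : A, mapPi1 functor (G.preStick.q a) = G'.preStick.q a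

attribute [instance] Hom.functor_monoidal

/-- A morphism of Gr-categories with pre-sticks of the type `(P, A)` is an equivalence. -/
theorem Hom.isEquivalence {G G' : PreStickedGrCategory P A} (F : Hom G G') :
    F.functor.IsEquivalence := by
  refine isEquivalence_of_bijective F.functor ?_ ?_
  · have h : mapPi0 F.functor ∘ G.preStick.p = G'.preStick.p := funext F.mapPi0_p
    rw [← Function.Bijective.of_comp_iff _ G.preStick.p.bijective, h]
    exact G'.preStick.p.bijective
  · have h : mapPi1 F.functor ∘ G.preStick.q = G'.preStick.q := funext F.mapPi1_q
    rw [← Function.Bijective.of_comp_iff _ G.preStick.q.bijective, h]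
    exact G'.preStick.q.bijective

/-- The identity morphism. -/
def Hom.refl (G : PreStickedGrCategory P A) : Hom G G where
  functor := 𝟭 G.carrier
  mapPi0_p s := by
    obtain ⟨X, hX⟩ := Pi0.mk_surjective G.carrier (G.preStick.p s)
    rw [← hX]
    rfl
  mapPi1_q a := mapPi1_id _

/-- The composition of morphisms. -/
def Hom.comp {G G' G'' : PreStickedGrCategory P A} (F : Hom G G') (F' : Hom G' G'') :
    Hom G G'' where
  functor := F.functor ⋙ F'.functor
  mapPi0_p s := by
    rw [← F'.mapPi0_p, ← F.mapPi0_p]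
    obtain ⟨X, hX⟩ := Pi0.mk_surjective G.carrier (G.preStick.p s)
    rw [← hX]
    rfl
  mapPi1_q a := by
    rw [mapPi1_comp, F.mapPi1_q, F'.mapPi1_q]

/-- A morphism has an inverse up to natural isomorphism. -/
theorem Hom.nonempty_symm {G G' : PreStickedGrCategory P A} (F : Hom G G') :
    Nonempty (Hom G' G) := by
  have := F.isEquivalence
  let e : G.carrier ≌ G'.carrier := F.functor.asEquivalence
  let _ : e.functor.Monoidal := F.functor_monoidal
  let _ : e.inverse.Monoidal := e.inverseMonoidal
  refine ⟨⟨e.inverse, fun s => ?_, fun a => ?_⟩⟩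
  · rw [← F.mapPi0_p]
    obtain ⟨X, hX⟩ := Pi0.mk_surjective G.carrier (G.preStick.p s)
    rw [← hX]
    exact (Pi0.mk_eq_iff _).2 ⟨(e.unitIso.app X).symm⟩
  · rw [← F.mapPi1_q]
    have h := mapPi1_comp e.functor e.inverse (G.preStick.q a)
    refine h.symm.trans (mapPi1_eq_of (e.functor ⋙ e.inverse) (𝟙_ G.carrier) _ _ ?_)
    rw [← cancel_epi (e.unitIso.hom.app (𝟙_ G.carrier)), ← gamma_natural]
    exact (e.unitIso.hom.naturality _).symm

variable (P A) in
/-- Gr-categories with pre-sticks of the type `(P, A)` are equivalent if there is a morphism from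
one to the other. -/
instance setoid : Setoid (PreStickedGrCategory P A) where
  r G G' := Nonempty (Hom G G')
  iseqv := ⟨fun G => ⟨Hom.refl G⟩, fun ⟨F⟩ => F.nonempty_symm, fun ⟨F⟩ ⟨F'⟩ => ⟨F.comp F'⟩⟩

end PreStickedGrCategory

/-- The equivalence classes of Gr-categories with pre-sticks of the type `(P, A)`. -/
def EquivClasses (P A : Type u) [Group P] [AddCommGroup A] [DistribMulAction P A] : Type (u + 1) :=
  Quotient (PreStickedGrCategory.setoid P A)

/-- The equivalence class of a Gr-category with a pre-stick of the type `(P, A)`. -/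
def EquivClasses.mk {P A : Type u} [Group P] [AddCommGroup A] [DistribMulAction P A]
    (G : PreStickedGrCategory P A) : EquivClasses P A :=
  Quotient.mk _ G

end

end GrCat

namespace GrCat

noncomputable section

/-! ### Third cohomology in terms of explicit cocycles -/

section CohomologyClasses

/-! The invariant of a Gr-category with a pre-stick is read off a `Frame`: objects X_s in the
classes p(s), with isomorphisms X_s ⊗ X_t ≅ X_{st}. Every automorphism of an object is given by a
unique element of A, so the failure of associativity of a frame is a function c : P³ → A; a stick
yields a frame whose c represents the value of Γ. Two frames of one Gr-category differ by
isomorphisms of their objects, which leave c unchanged, and by automorphisms β(s,t), which change c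
by a coboundary (`Frame.exists_cochain`). A morphism carries a frame to one with the same c, so the
class of c is invariant under morphisms.

Conversely, a cocycle c is the associativity constraint of a Gr-category `Reduced c`, with objects P
and automorphism groups A; the pentagon is the cocycle identity. It maps to every Gr-category having
a frame with associator c (`homOfFrame`). If two classes agree, twisting one frame makes the
cocycles equal, and both Gr-categories receive a morphism from the same reduced one. Morphisms being
invertible up to isomorphism, this proves `nonempty_hom_iff`, which contains well-definedness,
injectivity and independence of the stick. Surjectivity holds because `Reduced c` has class [c].

Cocycles are not normalized: the values c(1,1,t) and c(s,1,1) go into the unit constraints. -/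

theorem groupCohomology_π_eq_zero_iff {k G : Type u} [CommRing k] [Group G] {A : Rep.{u} k G}
    {n : ℕ} (x : groupCohomology.cocycles A (n + 1)) :
    groupCohomology.π A (n + 1) x = 0 ↔
      ∃ y : (Fin n → G) → A,
        inhomogeneousCochains.d A n y = groupCohomology.iCocycles A (n + 1) x := by
  let K := groupCohomology.inhomogeneousCochains A
  have hi : (ComplexShape.up ℕ).prev (n + 1) = n := by simp
  -- Cohomology is the cokernel of the differential corestricted to cocycles, so the kernel of the
  -- projection is the image of that differential.
  have hex : (ShortComplex.mk (K.toCycles n (n + 1)) (K.homologyπ (n + 1))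
      (K.toCycles_comp_homologyπ n (n + 1))).Exact :=
    ShortComplex.exact_of_g_is_cokernel _ (K.homologyIsCokernel n (n + 1) hi)
  have hd : ∀ y : (Fin n → G) → A,
      groupCohomology.iCocycles A (n + 1) (K.toCycles n (n + 1) y) =
        inhomogeneousCochains.d A n y := fun y => by
    rw [← groupCohomology.inhomogeneousCochains.d_def, ← K.toCycles_i n (n + 1)]
    rfl
  constructor
  · intro hx
    obtain ⟨y, hy⟩ := (ShortComplex.moduleCat_exact_iff _).1 hex x hx
    exact ⟨y, (hd y).symm.trans (congrArg _ hy)⟩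
  · rintro ⟨(y : (Fin _ → _) → A), hy⟩
    have hxy : x = K.toCycles n (n + 1) y :=
      (ModuleCat.mono_iff_injective (K.iCycles (n + 1))).1 inferInstance
        (hy.symm.trans (hd y).symm)
    rw [hxy]
    exact ConcreteCategory.congr_hom (K.toCycles_comp_homologyπ n (n + 1)) y

variable (P A : Type u) [Group P] [AddCommGroup A] [DistribMulAction P A]

/-- An inhomogeneous 3-cocycle of a group `P` with values in a `P`-module `A`. -/
structure Cocycle3 where
  toFun : P → P → P → A
  cocycle : ∀ r s t w, r • toFun s t w + toFun r (s * t) w + toFun r s t =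
    toFun r s (t * w) + toFun (r * s) t w

variable {P A}

theorem d_three_apply (f : (Fin 3 → P) → A) (g : Fin 4 → P) :
    inhomogeneousCochains.d (moduleRep P A) 3 f g =
      g 0 • f ![g 1, g 2, g 3] + f ![g 0, g 1 * g 2, g 3] + f ![g 0, g 1, g 2] -
        (f ![g 0, g 1, g 2 * g 3] + f ![g 0 * g 1, g 2, g 3]) := by
  refine (inhomogeneousCochains.d_hom_apply (moduleRep P A) 3 _ g).trans ?_
  have e₁ : (fun i : Fin 3 => g i.succ) = ![g 1, g 2, g 3] := by
    funext i; fin_cases i <;> rfl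
  have e₂ : Fin.contractNth 0 (· * ·) g = ![g 0 * g 1, g 2, g 3] := by
    funext i; fin_cases i <;> rfl
  have e₃ : Fin.contractNth 1 (· * ·) g = ![g 0, g 1 * g 2, g 3] := by
    funext i; fin_cases i <;> rfl
  have e₄ : Fin.contractNth 2 (· * ·) g = ![g 0, g 1, g 2 * g 3] := by
    funext i; fin_cases i <;> rfl
  have e₅ : Fin.contractNth 3 (· * ·) g = ![g 0, g 1, g 2] := by
    funext i; fin_cases i <;> rfl
  rw [Fin.sum_univ_four, e₁, e₂, e₃, e₄, e₅]
  have key : ∀ a b c d e : A, a + ((-1 : ULift.{u} ℤ) ^ 1 • b + (-1 : ULift.{u} ℤ) ^ 2 • c +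
      (-1 : ULift.{u} ℤ) ^ 3 • d + (-1 : ULift.{u} ℤ) ^ 4 • e) = a + c + e - (d + b) := by
    intro a b c d e
    have h₂ : Even 2 := by decide
    have h₃ : Odd 3 := by decide
    have h₄ : Even 4 := by decide
    rw [pow_one, h₂.neg_one_pow, h₃.neg_one_pow, h₄.neg_one_pow, neg_smul, neg_smul, one_smul,
      one_smul, one_smul, one_smul]
    abel
  exact key _ _ _ _ _

theorem d_two_apply (f : (Fin 2 → P) → A) (g : Fin 3 → P) :
    inhomogeneousCochains.d (moduleRep P A) 2 f g =
      g 0 • f ![g 1, g 2] + f ![g 0, g 1 * g 2] -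
        (f ![g 0, g 1] + f ![g 0 * g 1, g 2]) := by
  refine (inhomogeneousCochains.d_hom_apply (moduleRep P A) 2 _ g).trans ?_
  have e₁ : (fun i : Fin 2 => g i.succ) = ![g 1, g 2] := by
    funext i; fin_cases i <;> rfl
  have e₂ : Fin.contractNth 0 (· * ·) g = ![g 0 * g 1, g 2] := by
    funext i; fin_cases i <;> rfl
  have e₃ : Fin.contractNth 1 (· * ·) g = ![g 0, g 1 * g 2] := by
    funext i; fin_cases i <;> rfl
  have e₄ : Fin.contractNth 2 (· * ·) g = ![g 0, g 1] := by
    funext i; fin_cases i <;> rfl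
  rw [Fin.sum_univ_three, e₁, e₂, e₃, e₄]
  have key : ∀ a b c d : A, a + ((-1 : ULift.{u} ℤ) ^ 1 • b + (-1 : ULift.{u} ℤ) ^ 2 • c +
      (-1 : ULift.{u} ℤ) ^ 3 • d) = a + c - (d + b) := by
    intro a b c d
    have h₂ : Even 2 := by decide
    have h₃ : Odd 3 := by decide
    rw [pow_one, h₂.neg_one_pow, h₃.neg_one_pow, neg_smul, neg_smul, one_smul, one_smul, one_smul]
    abel
  exact key _ _ _ _

namespace Cocycle3

/-- A 3-cocycle as a function on `Fin 3 → P`. -/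
def cochain (c : Cocycle3 P A) : (Fin 3 → P) → A := fun g => c.toFun (g 0) (g 1) (g 2)

theorem d_cochain (c : Cocycle3 P A) :
    inhomogeneousCochains.d (moduleRep P A) 3 c.cochain = 0 := by
  funext g
  refine (d_three_apply c.cochain g).trans (sub_eq_zero.2 ?_)
  exact c.cocycle (g 0) (g 1) (g 2) (g 3)

/-- The class of a 3-cocycle in `H³(P, A)`. -/
def cohomologyClass (c : Cocycle3 P A) : H3 P A :=
  groupCohomology.π (moduleRep P A) 3 (groupCohomology.cocyclesMk c.cochain c.d_cochain)

theorem cohomologyClass_surjective :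
    Function.Surjective (cohomologyClass : Cocycle3 P A → H3 P A) := by
  intro x
  induction x using groupCohomology_induction_on with
  | h x =>
    let K := groupCohomology.inhomogeneousCochains (moduleRep P A)
    let f : (Fin 3 → P) → A := groupCohomology.iCocycles (moduleRep P A) 3 x
    have hf : inhomogeneousCochains.d (moduleRep P A) 3 f = 0 := by
      rw [← groupCohomology.inhomogeneousCochains.d_def]
      exact ConcreteCategory.congr_hom (K.iCycles_d 3 4) x
    let c : Cocycle3 P A := ⟨fun r s t => f ![r, s, t], fun r s t w =>
      sub_eq_zero.1 ((d_three_apply f ![r, s, t, w]).symm.trans (congrFun hf _))⟩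
    have hc : c.cochain = f := by
      funext g
      exact congrArg f (by funext i; fin_cases i <;> rfl)
    refine ⟨c, congrArg (groupCohomology.π (moduleRep P A) 3) ?_⟩
    apply (ModuleCat.mono_iff_injective (K.iCycles 3)).1 inferInstance
    exact (groupCohomology.iCocycles_mk _ _).trans hc

theorem cohomologyClass_eq_iff (c c' : Cocycle3 P A) :
    c.cohomologyClass = c'.cohomologyClass ↔
      ∃ β : P → P → A, ∀ r s t, c'.toFun r s t + r • β s t + β r (s * t) =
        c.toFun r s t + β r s + β (r * s) t := by
  rw [eq_comm, ← sub_eq_zero, cohomologyClass, cohomologyClass, ← map_sub,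
    groupCohomology_π_eq_zero_iff, map_sub]
  have hi : groupCohomology.iCocycles (moduleRep P A) 3
        (groupCohomology.cocyclesMk c'.cochain c'.d_cochain) -
      groupCohomology.iCocycles (moduleRep P A) 3
        (groupCohomology.cocyclesMk c.cochain c.d_cochain) = c'.cochain - c.cochain :=
    congrArg₂ (· - ·) (groupCohomology.iCocycles_mk _ _) (groupCohomology.iCocycles_mk _ _)
  constructor
  · rintro ⟨(y : (Fin _ → _) → A), hy⟩
    -- The sign: the relation reads c' − c = −dβ, the form in which β arises when a frame is
    -- twisted.
    refine ⟨fun s t => -y ![s, t], fun r s t => ?_⟩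
    have h : r • y ![s, t] + y ![r, s * t] - (y ![r, s] + y ![r * s, t]) =
        c'.toFun r s t - c.toFun r s t :=
      (d_two_apply y ![r, s, t]).symm.trans (congrFun (hy.trans hi) _)
    simp only [smul_neg]
    rw [← sub_eq_zero] at h ⊢
    rw [← neg_eq_zero, ← h]
    abel
  · rintro ⟨β, hβ⟩
    refine ⟨fun g => -β (g 0) (g 1), Eq.trans ?_ hi.symm⟩
    funext g
    refine (d_two_apply _ g).trans ?_
    change _ = c'.toFun (g 0) (g 1) (g 2) - c.toFun (g 0) (g 1) (g 2)
    have h := hβ (g 0) (g 1) (g 2)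
    change g 0 • -β (g 1) (g 2) + -β (g 0) (g 1 * g 2) -
      (-β (g 0) (g 1) + -β (g 0 * g 1) (g 2)) = _
    rw [smul_neg]
    rw [← sub_eq_zero] at h ⊢
    rw [← neg_eq_zero, ← h]
    abel

/-- The cocycle `(r, s, t) ↦ f (c (p r, p s, p t))`. -/
def pullback {P' A' : Type u} [Group P'] [AddCommGroup A'] [DistribMulAction P' A']
    (c : Cocycle3 P' A') (p : P →* P') (f : A' →+ A)
    (hf : ∀ (s : P) (a : A'), f (p s • a) = s • f a) : Cocycle3 P A where
  toFun r s t := f (c.toFun (p r) (p s) (p t))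
  cocycle r s t w := by
    rw [← hf, map_mul, map_mul, map_mul, ← map_add, ← map_add, c.cocycle, map_add]

/-- Cocycles inject into cochains, and on cochains the induced map is composition with p and f. -/
theorem map_cohomologyClass {P' A' : Type u} [Group P'] [AddCommGroup A'] [DistribMulAction P' A']
    (c : Cocycle3 P' A') (p : P →* P') (f : A' →+ A)
    (hf : ∀ (s : P) (a : A'), f (p s • a) = s • f a) :
    H3.map p f hf c.cohomologyClass = (c.pullback p f hf).cohomologyClass := by
  refine (groupCohomology.π_map_apply _ _ 3 _).trans
    (congrArg (groupCohomology.π (moduleRep P A) 3) ?_)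
  let K := groupCohomology.inhomogeneousCochains (moduleRep P A)
  apply (ModuleCat.mono_iff_injective (K.iCycles 3)).1 inferInstance
  refine Eq.trans ?_ (groupCohomology.iCocycles_mk _ _).symm
  let φ : Rep.res p (moduleRep P' A') ⟶ moduleRep P A := Rep.ofHom
    { toFun := f
      map_add' := f.map_add
      map_smul' := fun n a => map_zsmul f n.down a
      isIntertwining' := fun s => LinearMap.ext (hf s) }
  refine (ConcreteCategory.congr_hom (HomologicalComplex.cyclesMap_i
    (groupCohomology.cochainsMap p φ) 3) _).trans ?_
  exact congrArg ((groupCohomology.cochainsMap p φ).f 3) (groupCohomology.iCocycles_mk _ _)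

end Cocycle3

end CohomologyClasses

/-! ### Frames of a Gr-category and their associators -/

section Frames

variable {P A : Type u} [Group P] [AddCommGroup A] [DistribMulAction P A]
  {C : Type u} [Category.{u} C] [MonoidalCategory C] [IsGrCategory C]
  {D : Type u} [Category.{u} D] [MonoidalCategory D] [IsGrCategory D]

namespace PreStick

/-- The automorphism of `X` that corresponds to an element of `A` under a pre-stick of type
`(P, A)`. -/
def aut (ε : PreStick P A C) (X : C) (a : A) : X ⟶ X := (gamma X (ε.q a).toMul).hom

variable (ε : PreStick P A C)

theorem aut_zero (X : C) : ε.aut X 0 = 𝟙 X := by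
  rw [aut, map_zero, toMul_zero, map_one]
  rfl

theorem aut_add (X : C) (a b : A) : ε.aut X (a + b) = ε.aut X a ≫ ε.aut X b := by
  rw [aut, map_add, gamma_add]
  rfl

/-- Naturality lets all values of cochains slide to one end of a composite, where they add up. -/
theorem aut_comm {X Y : C} (f : X ⟶ Y) (a : A) : ε.aut X a ≫ f = f ≫ ε.aut Y a :=
  gamma_natural f _

theorem aut_comm_assoc {X Y Z : C} (f : X ⟶ Y) (a : A) (g : Y ⟶ Z) :
    ε.aut X a ≫ f ≫ g = f ≫ ε.aut Y a ≫ g := by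
  rw [reassoc_of% (ε.aut_comm f a)]

theorem aut_whiskerRight (X Y : C) (a : A) : ε.aut X a ▷ Y = ε.aut (X ⊗ Y) a :=
  (gamma_tensor X Y _).symm

/-- This brings the action of P into the associativity equation: tensoring on the left turns γ into
δ, which is γ of the translate by [X], and q is equivariant. -/
theorem whiskerLeft_aut {s : P} {X : C} (hX : Pi0.mk X = ε.p s) (Y : C) (a : A) :
    X ◁ ε.aut Y a = ε.aut (X ⊗ Y) (s • a) := by
  rw [aut, whiskerLeft_gamma, hX, ← ε.q_smul]
  rfl

theorem aut_injective (X : C) : Function.Injective (ε.aut X) := fun _ _ h =>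
  ε.q.injective (Additive.toMul.injective ((gamma_bijective X).1 (Iso.ext h)))

theorem aut_surjective (X : C) : Function.Surjective (ε.aut X) := fun f => by
  obtain ⟨v, hv⟩ := (gamma_bijective X).2 (asIso f)
  refine ⟨ε.q.symm (Additive.ofMul v), ?_⟩
  rw [aut, AddEquiv.apply_symm_apply, toMul_ofMul, hv]
  rfl

/-- `aut` as an isomorphism. -/
def autIso (X : C) (a : A) : X ≅ X := gamma X (ε.q a).toMul

@[simp]
theorem autIso_hom (X : C) (a : A) : (ε.autIso X a).hom = ε.aut X a := rfl

end PreStick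

/-- A choice, for a pre-stick `(p, q)`, of an object `X_s` in every class `p s`, and of isomorphisms
`X_s ⊗ X_t ≅ X_{st}`. -/
structure Frame (ε : PreStick P A C) where
  obj : P → C
  mk_obj : ∀ s, Pi0.mk (obj s) = ε.p s
  -- The free index n makes both bracketings of a triple product end in the same object, without
  -- transport along `mul_assoc`.
  mul : ∀ s t n : P, s * t = n → (obj s ⊗ obj t ≅ obj n)

namespace Frame

variable {ε : PreStick P A C}

/-- The function `c` measures the failure of associativity of the multiplication of a frame. -/
def IsAssociator (φ : Frame ε) (c : P → P → P → A) : Prop :=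
  ∀ (r s t rs st n : P) (h₁ : r * s = rs) (h₂ : s * t = st) (h₃ : r * st = n) (h₄ : rs * t = n),
    (α_ (φ.obj r) (φ.obj s) (φ.obj t)).inv ≫ (φ.mul r s rs h₁).hom ▷ φ.obj t ≫
      (φ.mul rs t n h₄).hom =
    φ.obj r ◁ (φ.mul s t st h₂).hom ≫ (φ.mul r st n h₃).hom ≫ ε.aut (φ.obj n) (c r s t)

theorem IsAssociator.unique {φ : Frame ε} {c c' : P → P → P → A} (h : φ.IsAssociator c)
    (h' : φ.IsAssociator c') (r s t : P) : c r s t = c' r s t := by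
  have e := (h r s t _ _ _ rfl rfl (mul_assoc r s t).symm rfl).symm.trans
    (h' r s t _ _ _ rfl rfl (mul_assoc r s t).symm rfl)
  exact ε.aut_injective _ ((cancel_epi _).1 ((cancel_epi _).1 e))

variable (ε) in
/-- The frame given by a stick. -/
def ofStick (σ : Stick C) : Frame ε where
  obj s := σ.rep (ε.p s)
  mk_obj s := σ.mk_rep _
  mul s t n h := σ.mulIso (ε.p s) (ε.p t) (ε.p n) (by rw [← map_mul, h])

theorem isAssociator_ofStick (σ : Stick C) :
    (ofStick ε σ).IsAssociator
      fun r s t => ε.q.symm (σ.assoc (ε.p r) (ε.p s) (ε.p t)) := by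
  intro r s t rs st n h₁ h₂ h₃ h₄
  have e : ∀ X a, ε.aut X (ε.q.symm a) = (gamma X a.toMul).hom := fun X a => by
    rw [PreStick.aut, AddEquiv.apply_symm_apply]
  rw [e]
  exact σ.gamma_assoc (by rw [← map_mul, h₁]) (by rw [← map_mul, h₂]) (by rw [← map_mul, h₃])
    (by rw [← map_mul, h₄])

/-- Multiplication of the structure isomorphisms of a frame by a 2-cochain. -/
def twist (φ : Frame ε) (β : P → P → A) : Frame ε where
  obj := φ.obj
  mk_obj := φ.mk_obj
  mul s t n h := φ.mul s t n h ≪≫ ε.autIso _ (β s t)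

/-- Slide the inserted automorphisms to the end: one bracketing collects β(r,s) and β(rs,t), the
other r • β(s,t) and β(r,st), the action coming from left whiskering. -/
theorem IsAssociator.twist {φ : Frame ε} {c c' : P → P → P → A} (h : φ.IsAssociator c)
    (β : P → P → A)
    (hc : ∀ r s t, c' r s t + r • β s t + β r (s * t) = c r s t + β r s + β (r * s) t) :
    (φ.twist β).IsAssociator c' := by
  intro r s t rs st n h₁ h₂ h₃ h₄
  have e := h r s t rs st n h₁ h₂ h₃ h₄
  have hc' := hc r s t
  subst h₁ h₂
  simp only [Frame.twist, Iso.trans_hom, PreStick.autIso_hom, comp_whiskerRight,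
    MonoidalCategory.whiskerLeft_comp, Category.assoc]
  rw [ε.whiskerLeft_aut (φ.mk_obj r), ε.aut_whiskerRight, ε.aut_comm_assoc, ε.aut_comm_assoc,
    reassoc_of% e]
  simp only [← ε.aut_add]
  rw [← add_assoc, ← hc']
  congr 3
  abel

/-- Transport of a frame along isomorphisms of its objects. -/
def transport (φ : Frame ε) (X : P → C) (j : ∀ s, φ.obj s ≅ X s) : Frame ε where
  obj := X
  mk_obj s := ((Pi0.mk_eq_iff C).2 ⟨(j s).symm⟩).trans (φ.mk_obj s)
  mul s t n h := (tensorIso (j s) (j t)).symm ≪≫ φ.mul s t n h ≪≫ j n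

/-- The intermediate isomorphisms cancel by naturality of the associator, and the defect commutes
with the last one. -/
theorem IsAssociator.transport {φ : Frame ε} {c : P → P → P → A} (h : φ.IsAssociator c)
    (X : P → C) (j : ∀ s, φ.obj s ≅ X s) : (φ.transport X j).IsAssociator c := by
  intro r s t rs st n h₁ h₂ h₃ h₄
  have e := h r s t rs st n h₁ h₂ h₃ h₄
  simp only [Frame.transport, Iso.trans_hom, Iso.symm_hom, tensorIso_inv]
  rw [← cancel_epi ((j r).hom ⊗ₘ ((j s).hom ⊗ₘ (j t).hom))]
  simp only [Category.assoc]
  have e₁ : ((j r).hom ⊗ₘ ((j s).hom ⊗ₘ (j t).hom)) ≫ (α_ (X r) (X s) (X t)).inv ≫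
      (((j r).inv ⊗ₘ (j s).inv) ≫ (φ.mul r s rs h₁).hom ≫ (j rs).hom) ▷ X t ≫
        ((j rs).inv ⊗ₘ (j t).inv) =
      (α_ _ _ _).inv ≫ (φ.mul r s rs h₁).hom ▷ φ.obj t := by
    rw [associator_inv_naturality_assoc, ← tensorHom_id, tensorHom_comp_tensorHom,
      tensorHom_comp_tensorHom, ← tensorHom_id]
    simp
  have e₂ : ((j r).hom ⊗ₘ ((j s).hom ⊗ₘ (j t).hom)) ≫
      X r ◁ (((j s).inv ⊗ₘ (j t).inv) ≫ (φ.mul s t st h₂).hom ≫ (j st).hom) ≫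
        ((j r).inv ⊗ₘ (j st).inv) = φ.obj r ◁ (φ.mul s t st h₂).hom := by
    rw [← id_tensorHom, tensorHom_comp_tensorHom, tensorHom_comp_tensorHom, ← id_tensorHom]
    simp
  rw [reassoc_of% e₁, reassoc_of% e₂, reassoc_of% e, ε.aut_comm]

/-- After transport both frames have the same objects, so their multiplications differ by
automorphisms, that is, by elements β(s,t) of A. -/
theorem exists_cochain {φ φ' : Frame ε} {c c' : P → P → P → A} (h : φ.IsAssociator c)
    (h' : φ'.IsAssociator c') : ∃ β : P → P → A, ∀ r s t,
      c' r s t + r • β s t + β r (s * t) = c r s t + β r s + β (r * s) t := by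
  have j : ∀ s, φ.obj s ≅ φ'.obj s := fun s =>
    ((Pi0.mk_eq_iff C).1 ((φ.mk_obj s).trans (φ'.mk_obj s).symm)).some
  let ψ := φ.transport φ'.obj j
  have hψ : ψ.IsAssociator c := h.transport φ'.obj j
  have hβ : ∀ s t, ∃ b : A,
      ε.aut _ b = (ψ.mul s t (s * t) rfl).inv ≫ (φ'.mul s t (s * t) rfl).hom := fun s t =>
    ε.aut_surjective _ _
  choose β hβ using hβ
  refine ⟨β, fun r s t => ?_⟩
  -- The associator of the twisted frame, solved from the twisting relation; uniqueness of the
  -- associator then identifies it with the given c'.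
  have hc := hψ.twist (c' := fun r s t => c r s t + β r s + β (r * s) t -
    (r • β s t + β r (s * t))) β (fun r s t => by abel)
  have e : ψ.twist β = φ' := by
    have hm : (ψ.twist β).mul = φ'.mul := by
      funext s t n h
      subst h
      ext
      exact (congrArg _ (hβ s t)).trans (Iso.hom_inv_id_assoc _ _)
    cases φ'
    exact congrArg _ hm
  rw [e] at hc
  rw [h'.unique hc]
  abel

open Functor.LaxMonoidal Functor.OplaxMonoidal Functor.Monoidal in
/-- The image of a frame under a morphism. -/
def map {ε' : PreStick P A D} (φ : Frame ε) (F : C ⥤ D) [F.Monoidal]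
    (h₀ : ∀ s : P, mapPi0 F (ε.p s) = ε'.p s) : Frame ε' where
  obj s := F.obj (φ.obj s)
  mk_obj s := by
    rw [← h₀, ← φ.mk_obj]
    rfl
  mul s t n h := μIso F _ _ ≪≫ F.mapIso (φ.mul s t n h)

open Functor.LaxMonoidal Functor.OplaxMonoidal Functor.Monoidal in
-- The tensorator of F is coherent with associativity, and F respects the automorphisms given by A
-- because F₁ q = q'.
theorem IsAssociator.map {ε' : PreStick P A D} {φ : Frame ε} {c : P → P → P → A}
    (h : φ.IsAssociator c) (F : C ⥤ D) [F.Monoidal]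
    (h₀ : ∀ s : P, mapPi0 F (ε.p s) = ε'.p s) (h₁ : ∀ a : A, mapPi1 F (ε.q a) = ε'.q a) :
    (φ.map F h₀).IsAssociator c := by
  intro r s t rs st n k₁ k₂ k₃ k₄
  have e := congrArg F.map (h r s t rs st n k₁ k₂ k₃ k₄)
  have ea : ∀ X a, F.map (ε.aut X a) = ε'.aut (F.obj X) a := fun X a => by
    rw [PreStick.aut, map_gamma, h₁]
    rfl
  simp only [Functor.map_comp, ea] at e
  simp only [Frame.map, Iso.trans_hom, μIso_hom, Functor.mapIso_hom, comp_whiskerRight,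
    MonoidalCategory.whiskerLeft_comp, Category.assoc]
  rw [μ_natural_left_assoc, μ_natural_right_assoc, ← e, ← Functor.LaxMonoidal.associativity_inv_assoc]

end Frame

end Frames

/-! ### The reduced Gr-category of a 3-cocycle -/

section Reduced

variable {P A : Type u} [Group P] [AddCommGroup A] [DistribMulAction P A]

/-- The objects of the reduced Gr-category of a 3-cocycle: the elements of `P`. -/
@[ext]
structure Reduced (c : Cocycle3 P A) : Type u where
  val : P

namespace Reduced

variable {c : Cocycle3 P A}

/-- The morphisms of the reduced Gr-category: they are the elements of `A`, and their source and
target agree. -/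
@[ext]
structure Hom (X Y : Reduced c) : Type u where
  val_eq : X.val = Y.val
  val : A

instance : Category.{u} (Reduced c) where
  Hom X Y := Hom X Y
  id _ := ⟨rfl, 0⟩
  comp f g := ⟨f.val_eq.trans g.val_eq, f.val + g.val⟩
  id_comp _ := Hom.ext (zero_add _)
  comp_id _ := Hom.ext (add_zero _)
  assoc _ _ _ := Hom.ext (add_assoc _ _ _)

@[ext]
theorem hom_ext {X Y : Reduced c} {f g : X ⟶ Y} (h : f.val = g.val) : f = g := Hom.ext h

@[simp]
theorem id_val (X : Reduced c) : Hom.val (𝟙 X) = 0 := rfl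

@[simp]
theorem comp_val {X Y Z : Reduced c} (f : X ⟶ Y) (g : Y ⟶ Z) :
    (f ≫ g).val = f.val + g.val := rfl

/-- The isomorphism given by an element of `A`. -/
def mkIso {X Y : Reduced c} (h : X.val = Y.val) (a : A) : X ≅ Y where
  hom := ⟨h, a⟩
  inv := ⟨h.symm, -a⟩
  hom_inv_id := hom_ext (add_neg_cancel a)
  inv_hom_id := hom_ext (neg_add_cancel a)

@[simp]
theorem mkIso_hom_val {X Y : Reduced c} (h : X.val = Y.val) (a : A) :
    (mkIso h a).hom.val = a := rfl

/-- The associator `α_` is inverse to the constraint that c measures, hence the sign. The unit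
constraints are chosen so that the triangle holds for an unnormalized c. -/
instance : MonoidalCategoryStruct (Reduced c) where
  tensorObj X Y := ⟨X.val * Y.val⟩
  whiskerLeft X _ _ f := ⟨congrArg (X.val * ·) f.val_eq, X.val • f.val⟩
  whiskerRight f Z := ⟨congrArg (· * Z.val) f.val_eq, f.val⟩
  tensorHom {X _ _ _} f g := ⟨congrArg₂ (· * ·) f.val_eq g.val_eq, f.val + X.val • g.val⟩
  tensorUnit := ⟨1⟩
  associator X Y Z := mkIso (mul_assoc _ _ _) (-c.toFun X.val Y.val Z.val)
  leftUnitor X := mkIso (one_mul _) (c.toFun 1 1 X.val)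
  rightUnitor X := mkIso (mul_one _) (-c.toFun X.val 1 1)

@[simp]
theorem tensor_val (X Y : Reduced c) : (X ⊗ Y).val = X.val * Y.val := rfl

@[simp]
theorem unit_val : (𝟙_ (Reduced c)).val = 1 := rfl

@[simp]
theorem whiskerLeft_val (X : Reduced c) {Y Z : Reduced c} (f : Y ⟶ Z) :
    (X ◁ f).val = X.val • f.val := rfl

@[simp]
theorem whiskerRight_val {X Y : Reduced c} (f : X ⟶ Y) (Z : Reduced c) :
    (f ▷ Z).val = f.val := rfl

@[simp]
theorem tensorHom_val {X Y Z W : Reduced c} (f : X ⟶ Y) (g : Z ⟶ W) :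
    (f ⊗ₘ g).val = f.val + X.val • g.val := rfl

@[simp]
theorem associator_hom_val (X Y Z : Reduced c) :
    (α_ X Y Z).hom.val = -c.toFun X.val Y.val Z.val := rfl

@[simp]
theorem associator_inv_val (X Y Z : Reduced c) :
    (α_ X Y Z).inv.val = c.toFun X.val Y.val Z.val := neg_neg _

@[simp]
theorem leftUnitor_hom_val (X : Reduced c) : (λ_ X).hom.val = c.toFun 1 1 X.val := rfl

@[simp]
theorem leftUnitor_inv_val (X : Reduced c) : (λ_ X).inv.val = -c.toFun 1 1 X.val := rfl

@[simp]
theorem rightUnitor_hom_val (X : Reduced c) : (ρ_ X).hom.val = -c.toFun X.val 1 1 := rfl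

@[simp]
theorem rightUnitor_inv_val (X : Reduced c) : (ρ_ X).inv.val = c.toFun X.val 1 1 := neg_neg _

instance : MonoidalCategory (Reduced c) where
  tensorHom_def {X Y Z W} f g := hom_ext <| by
    simp only [tensorHom_val, comp_val, whiskerRight_val, whiskerLeft_val]
    rw [f.val_eq]
  id_tensorHom_id X Y := hom_ext <| by simp
  tensorHom_comp_tensorHom {X Y Z W V U} f g h k := hom_ext <| by
    simp only [tensorHom_val, comp_val, smul_add]
    rw [f.val_eq]
    abel
  whiskerLeft_id X Y := hom_ext <| by simp
  id_whiskerRight X Y := hom_ext <| by simp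
  associator_naturality {X Y Z W V U} f g h := hom_ext <| by
    have hf : X.val = _ := f.val_eq
    have hg : Y.val = _ := g.val_eq
    have hh : Z.val = _ := h.val_eq
    simp only [tensorHom_val, comp_val, associator_hom_val, tensor_val, smul_add, mul_smul, hf, hg,
      hh]
    abel
  leftUnitor_naturality {X Y} f := hom_ext <| by
    have hf : X.val = _ := f.val_eq
    simp [hf, add_comm]
  rightUnitor_naturality {X Y} f := hom_ext <| by
    have hf : X.val = _ := f.val_eq
    simp [hf, add_comm]
  pentagon W X Y Z := hom_ext <| by
    simp only [comp_val, whiskerRight_val, whiskerLeft_val, associator_hom_val, tensor_val,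
      smul_neg]
    rw [← neg_add, ← neg_add, ← neg_add, neg_inj, add_comm (c.toFun (_ * _) _ _), ← c.cocycle]
    abel
  triangle X Y := hom_ext <| by
    -- At (X, 1, 1, Y) one copy of c(X,1,Y) cancels, leaving X • c(1,1,Y) + c(X,1,1) = c(X,1,Y),
    -- which is the triangle.
    have h := c.cocycle X.val 1 1 Y.val
    simp only [one_mul, mul_one] at h
    simp only [comp_val, whiskerRight_val, whiskerLeft_val, associator_hom_val, leftUnitor_hom_val,
      rightUnitor_hom_val, unit_val]
    rw [← sub_eq_zero] at h ⊢
    rw [← h]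
    abel

instance : IsGrCategory (Reduced c) where
  all_isIso f := ⟨⟨f.val_eq.symm, -f.val⟩, hom_ext (add_neg_cancel _), hom_ext (neg_add_cancel _)⟩
  exists_inverse X := ⟨⟨X.val⁻¹⟩, ⟨mkIso (mul_inv_cancel _) 0⟩, ⟨mkIso (inv_mul_cancel _) 0⟩⟩

theorem gamma_val (X : Reduced c) (u : Aut (𝟙_ (Reduced c))) :
    (gamma X u).hom.val = u.hom.val := by
  simp [gamma_hom]

theorem delta_val (X : Reduced c) (u : Aut (𝟙_ (Reduced c))) :
    (delta X u).hom.val = X.val • u.hom.val := by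
  simp [delta_hom]

variable (c)

/-- The isomorphism `P ≃* π₀` for the reduced Gr-category. -/
def pi0Equiv : P ≃* Pi0 (Reduced c) :=
  MulEquiv.ofBijective
    ({ toFun := fun s => Pi0.mk ⟨s⟩
       map_mul' := fun _ _ => rfl } : P →ₙ* Pi0 (Reduced c))
    ⟨fun _ _ h => ((Pi0.mk_eq_iff _).1 h).some.hom.val_eq, fun x => by
      obtain ⟨X, rfl⟩ := Pi0.mk_surjective _ x
      exact ⟨X.val, rfl⟩⟩

/-- The isomorphism `A ≃+ π₁` for the reduced Gr-category. -/
def pi1Equiv : A ≃+ Pi1 (Reduced c) where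
  toFun a := Additive.ofMul (mkIso rfl a)
  invFun u := u.toMul.hom.val
  left_inv _ := rfl
  right_inv _ := Additive.toMul.injective (Iso.ext rfl)
  -- The product in `Aut` is composition in the reverse order.
  map_add' a b := Additive.toMul.injective (Iso.ext (hom_ext (add_comm a b)))

/-- The pre-stick of the reduced Gr-category. -/
def preStick : PreStick P A (Reduced c) where
  p := pi0Equiv c
  q := pi1Equiv c
  q_smul s a := by
    apply Additive.toMul.injective
    -- Here γ preserves the value in A and δ multiplies it by s.
    apply (gamma_bijective (⟨s⟩ : Reduced c)).1
    refine Eq.trans ?_ (gamma_act (⟨s⟩ : Reduced c) (mkIso rfl a)).symm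
    exact Iso.ext (hom_ext ((gamma_val _ _).trans
      (delta_val (⟨s⟩ : Reduced c) (mkIso rfl a : 𝟙_ (Reduced c) ≅ 𝟙_ (Reduced c))).symm))

/-- The reduced Gr-category of a 3-cocycle, with its pre-stick. -/
def grCategory : PreStickedGrCategory P A where
  carrier := Reduced c
  preStick := preStick c

theorem aut_val (X : Reduced c) (a : A) : Hom.val ((preStick c).aut X a) = a :=
  gamma_val X _

/-- The tautological frame of the reduced Gr-category. -/
def frame : Frame (preStick c) where
  obj s := ⟨s⟩
  mk_obj _ := rfl
  mul _ _ _ h := mkIso h 0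

theorem isAssociator_frame : (frame c).IsAssociator c.toFun := by
  intro r s t rs st n h₁ h₂ h₃ h₄
  apply hom_ext
  simp only [comp_val, aut_val]
  simp [frame]

end Reduced

end Reduced

/-! ### The monoidal functor from the reduced Gr-category given by a frame -/

namespace Frame

variable {P A : Type u} [Group P] [AddCommGroup A] [DistribMulAction P A]
  {C : Type u} [Category.{u} C] [MonoidalCategory C] [IsGrCategory C]
  {ε : PreStick P A C} (φ : Frame ε) (c : Cocycle3 P A)

/-- The free third index of `mul` absorbs the `eqToHom` in the values of `reducedFunctor`. -/
theorem mul_hom_comp_eqToHom {s t n n' : P} (h : s * t = n) (e : n = n')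
    (e' : φ.obj n = φ.obj n') :
    (φ.mul s t n h).hom ≫ eqToHom e' = (φ.mul s t n' (h.trans e)).hom := by
  subst e
  simp

theorem mul_hom_comp_eqToHom_assoc {s t n n' : P} (h : s * t = n) (e : n = n')
    (e' : φ.obj n = φ.obj n') {Z : C} (f : φ.obj n' ⟶ Z) :
    (φ.mul s t n h).hom ≫ eqToHom e' ≫ f = (φ.mul s t n' (h.trans e)).hom ≫ f := by
  rw [← φ.mul_hom_comp_eqToHom h e e', Category.assoc]

/-- The functor from a reduced Gr-category given by a frame. -/
@[simps]
def reducedFunctor : Reduced c ⥤ C where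
  obj X := φ.obj X.val
  map f := eqToHom (congrArg φ.obj f.val_eq) ≫ ε.aut _ f.val
  map_id X := by simp [PreStick.aut_zero]
  map_comp f g := by simp [PreStick.aut_add, PreStick.aut_comm_assoc]

/-- Tensoring with X_1 on the right is full, so the required map I ⊗ X_1 → X_1 ⊗ X_1 comes from a
map I → X_1. The latter will be the unit comparison of the functor. -/
theorem exists_unit : ∃ e : 𝟙_ C ≅ φ.obj 1,
    e.hom ▷ φ.obj 1 ≫ (φ.mul 1 1 1 (mul_one 1)).hom = (λ_ (φ.obj 1)).hom := by
  have := tensorRight_isEquivalence (φ.obj 1)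
  obtain ⟨e, he⟩ := (tensorRight (φ.obj 1)).map_surjective
    ((λ_ (φ.obj 1)).hom ≫ (φ.mul 1 1 1 (mul_one 1)).inv)
  exact ⟨asIso e, (congrArg (· ≫ (φ.mul 1 1 1 (mul_one 1)).hom) he).trans (by simp)⟩

variable {φ c}

/-- Precompose associativity at (1,1,t) with e in the first factor. The equation for e turns one
side into a left unitor, and m_{1,t} can be cancelled. -/
theorem IsAssociator.unit_mul (h : φ.IsAssociator c.toFun) {e : 𝟙_ C ≅ φ.obj 1}
    (he : e.hom ▷ φ.obj 1 ≫ (φ.mul 1 1 1 (mul_one 1)).hom = (λ_ (φ.obj 1)).hom) (t : P) :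
    (λ_ (φ.obj t)).hom =
      e.hom ▷ φ.obj t ≫ (φ.mul 1 t t (one_mul t)).hom ≫ ε.aut (φ.obj t) (c.toFun 1 1 t) := by
  have k := e.hom ▷ (φ.obj 1 ⊗ φ.obj t) ≫=
    h 1 1 t 1 t t (mul_one 1) (one_mul t) (one_mul t) (one_mul t)
  rw [← whisker_exchange_assoc, associator_inv_naturality_left_assoc, ← comp_whiskerRight_assoc, he,
    ← leftUnitor_tensor_hom_assoc, ← leftUnitor_naturality, cancel_epi] at k
  exact k

/-- Use associativity at (s,1,1) with e in the middle factor and the triangle identity. The result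
holds after tensoring with X_1, which is faithful. -/
theorem IsAssociator.mul_unit (h : φ.IsAssociator c.toFun) {e : 𝟙_ C ≅ φ.obj 1}
    (he : e.hom ▷ φ.obj 1 ≫ (φ.mul 1 1 1 (mul_one 1)).hom = (λ_ (φ.obj 1)).hom) (s : P) :
    (ρ_ (φ.obj s)).hom =
      φ.obj s ◁ e.hom ≫ (φ.mul s 1 s (mul_one s)).hom ≫ ε.aut (φ.obj s) (-c.toFun s 1 1) := by
  have := tensorRight_isEquivalence (φ.obj 1)
  have k := φ.obj s ◁ e.hom ▷ φ.obj 1 ≫=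
    h s 1 1 s 1 s (mul_one s) (mul_one 1) (mul_one s) (mul_one s)
  rw [associator_inv_naturality_middle_assoc, ← whiskerLeft_comp_assoc, he,
    ← comp_whiskerRight_assoc, ← triangle_assoc_comp_right, Category.assoc, cancel_epi,
    ← ε.aut_comm (φ.mul s 1 s (mul_one s)).hom, ← ε.aut_whiskerRight, ← comp_whiskerRight_assoc,
    cancel_mono] at k
  have k' := (tensorRight (φ.obj 1)).map_injective k
  rw [← Category.assoc, k', Category.assoc, ← ε.aut_add, add_neg_cancel, ε.aut_zero,
    Category.comp_id]

/-- The functor from a reduced Gr-category given by a frame is monoidal. -/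
def reducedFunctorCoreMonoidal (h : φ.IsAssociator c.toFun) :
    (φ.reducedFunctor c).CoreMonoidal where
  εIso := φ.exists_unit.choose
  μIso X Y := φ.mul X.val Y.val _ rfl
  μIso_hom_natural_left {X Y} f Z := by
    obtain ⟨s⟩ := X
    obtain ⟨t⟩ := Y
    obtain ⟨e, a⟩ := f
    obtain rfl : s = t := e
    simp only [reducedFunctor_map, eqToHom_refl, Category.id_comp, Reduced.whiskerRight_val]
    exact (congrArg (· ≫ _) (ε.aut_whiskerRight _ _ _)).trans (ε.aut_comm _ _)
  μIso_hom_natural_right {X Y} Z f := by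
    obtain ⟨s⟩ := X
    obtain ⟨t⟩ := Y
    obtain ⟨e, a⟩ := f
    obtain rfl : s = t := e
    simp only [reducedFunctor_map, eqToHom_refl, Category.id_comp, Reduced.whiskerLeft_val]
    exact (congrArg (· ≫ _) (ε.whiskerLeft_aut (φ.mk_obj Z.val) _ _)).trans (ε.aut_comm _ _)
  associativity X Y Z := by
    -- Composing with −c moves the defect to the side containing the image of the associator, whose
    -- value is −c.
    have k := h X.val Y.val Z.val _ _ _ rfl rfl rfl (mul_assoc _ _ _) =≫
      ε.aut _ (-c.toFun X.val Y.val Z.val)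
    simp only [Category.assoc, ← ε.aut_add, add_neg_cancel, ε.aut_zero, Category.comp_id] at k
    rw [← cancel_epi (α_ _ _ _).inv, Iso.inv_hom_id_assoc]
    simp only [reducedFunctor_map, Reduced.associator_hom_val]
    refine (congrArg _ (congrArg _ (φ.mul_hom_comp_eqToHom_assoc rfl (mul_assoc _ _ _) _ _))).trans
      k
  left_unitality X := by
    refine (h.unit_mul φ.exists_unit.choose_spec X.val).trans ?_
    simp only [reducedFunctor_map, Reduced.leftUnitor_hom_val]
    exact congrArg _ (φ.mul_hom_comp_eqToHom_assoc rfl (one_mul _) _ _).symm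
  right_unitality X := by
    refine (h.mul_unit φ.exists_unit.choose_spec X.val).trans ?_
    simp only [reducedFunctor_map, Reduced.rightUnitor_hom_val]
    exact congrArg _ (φ.mul_hom_comp_eqToHom_assoc rfl (mul_one _) _ _).symm

end Frame

/-! ### Comparison of morphisms with cohomology classes -/

namespace PreStickedGrCategory

variable {P A : Type u} [Group P] [AddCommGroup A] [DistribMulAction P A]

/-- A frame with associator `c` of a Gr-category defines a morphism from the reduced Gr-category of
`c`. -/
def homOfFrame (G : PreStickedGrCategory P A) {φ : Frame G.preStick} {c : Cocycle3 P A}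
    (h : φ.IsAssociator c.toFun) : Hom (Reduced.grCategory c) G :=
  letI F : Reduced c ⥤ G.carrier := φ.reducedFunctor c
  letI : F.Monoidal := (Frame.reducedFunctorCoreMonoidal h).toMonoidal
  { functor := F
    functor_monoidal := this
    mapPi0_p := fun s => φ.mk_obj s
    mapPi1_q := fun a => by
      -- The map on π₁ can be tested on a single object.
      refine mapPi1_eq_of F (𝟙_ (Reduced c)) _ _ ?_
      refine (congrArg F.map (Reduced.hom_ext (Reduced.aut_val c _ a) :
        (Reduced.preStick c).aut (𝟙_ (Reduced c)) a = ⟨rfl, a⟩)).trans ?_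
      exact Category.id_comp _ }

/-- A morphism puts a frame with associator c on G', to be compared with φ'. Conversely, twisting φ
by β gives it associator c', so `Reduced c'` maps to both G and G'. -/
theorem nonempty_hom_iff {G G' : PreStickedGrCategory P A} {φ : Frame G.preStick}
    {φ' : Frame G'.preStick} {c c' : Cocycle3 P A} (h : φ.IsAssociator c.toFun)
    (h' : φ'.IsAssociator c'.toFun) :
    Nonempty (Hom G G') ↔ c.cohomologyClass = c'.cohomologyClass := by
  rw [Cocycle3.cohomologyClass_eq_iff]
  constructor
  · rintro ⟨F⟩
    exact Frame.exists_cochain (h.map F.functor F.mapPi0_p F.mapPi1_q) h'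
  · rintro ⟨β, hβ⟩
    obtain ⟨F⟩ := (homOfFrame G (h.twist β hβ)).nonempty_symm
    exact ⟨F.comp (homOfFrame G' h')⟩

/-- The cocycle of a stick, transported along the pre-stick. -/
def cocycle (G : PreStickedGrCategory P A) (σ : Stick G.carrier) : Cocycle3 P A :=
  Cocycle3.pullback ⟨σ.assoc, σ.assoc_cocycle⟩ G.preStick.p.toMonoidHom
    G.preStick.q.symm.toAddMonoidHom fun s a => by
      apply G.preStick.q.injective
      refine (G.preStick.q.apply_symm_apply _).trans ?_
      rw [G.preStick.q_smul]
      exact congrArg (G.preStick.p s • ·) (G.preStick.q.apply_symm_apply a).symm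

theorem transfer_cohomologyClass (G : PreStickedGrCategory P A) (σ : Stick G.carrier) :
    G.preStick.transfer σ.cohomologyClass = (G.cocycle σ).cohomologyClass :=
  Cocycle3.map_cohomologyClass ⟨σ.assoc, σ.assoc_cocycle⟩ _ _ _

theorem nonempty_hom_iff_transfer_eq (G G' : PreStickedGrCategory P A) (σ : Stick G.carrier)
    (σ' : Stick G'.carrier) : Nonempty (Hom G G') ↔
      G.preStick.transfer σ.cohomologyClass = G'.preStick.transfer σ'.cohomologyClass := by
  rw [transfer_cohomologyClass, transfer_cohomologyClass]
  exact nonempty_hom_iff (c := G.cocycle σ) (c' := G'.cocycle σ')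
    (Frame.isAssociator_ofStick σ) (Frame.isAssociator_ofStick σ')

/-- The identity morphism compares the frame of the stick with the tautological frame, whose
associator is c. -/
theorem transfer_cohomologyClass_reduced (c : Cocycle3 P A)
    (σ : Stick (Reduced.grCategory c).carrier) :
    (Reduced.grCategory c).preStick.transfer σ.cohomologyClass = c.cohomologyClass := by
  rw [transfer_cohomologyClass]
  exact (nonempty_hom_iff (c := (Reduced.grCategory c).cocycle σ) (c' := c)
    (Frame.isAssociator_ofStick σ) (Reduced.isAssociator_frame c)).1 ⟨Hom.refl _⟩

end PreStickedGrCategory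

end

end GrCat

theorem theorem3p2 (P A : Type u) [Group P] [AddCommGroup A] [DistribMulAction P A] :
    ∃ Γ : GrCat.EquivClasses P A → GrCat.H3 P A,
      Function.Bijective Γ ∧
        ∀ (G : GrCat.PreStickedGrCategory P A) (σ : GrCat.Stick G.carrier),
          Γ (GrCat.EquivClasses.mk G) = G.preStick.transfer σ.cohomologyClass := by
  have hmk : Function.Surjective (GrCat.EquivClasses.mk (P := P) (A := A)) :=
    Quotient.mk_surjective
  let σ : ∀ G : GrCat.PreStickedGrCategory P A, GrCat.Stick G.carrier := fun _ =>
    Classical.arbitrary _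
  let Γ : GrCat.EquivClasses P A → GrCat.H3 P A :=
    Quotient.lift (fun G => G.preStick.transfer (σ G).cohomologyClass) fun G G' h =>
      (GrCat.PreStickedGrCategory.nonempty_hom_iff_transfer_eq G G' (σ G) (σ G')).1 h
  refine ⟨Γ, ⟨fun x y h => ?_, fun x => ?_⟩, fun G τ => ?_⟩
  · obtain ⟨G, rfl⟩ := hmk x
    obtain ⟨G', rfl⟩ := hmk y
    exact Quotient.sound
      ((GrCat.PreStickedGrCategory.nonempty_hom_iff_transfer_eq G G' (σ G) (σ G')).2 h)
  · obtain ⟨c, rfl⟩ := GrCat.Cocycle3.cohomologyClass_surjective x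
    exact ⟨GrCat.EquivClasses.mk (GrCat.Reduced.grCategory c),
      GrCat.PreStickedGrCategory.transfer_cohomologyClass_reduced c (σ _)⟩
  -- Independence of the stick: the criterion applied to the identity of G and two different sticks.
  · exact (GrCat.PreStickedGrCategory.nonempty_hom_iff_transfer_eq G G (σ G) τ).1
      ⟨GrCat.PreStickedGrCategory.Hom.refl G⟩
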